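/- **Setting.** Let $(\Omega,\mathcal F,\mu)$ be a complete $\sigma$-finite measure space, let $(\mathsf H_\omega)_{\omega\in\Omega}$ be a family of real Hilbert spaces, and let $\mathfrak G$ be a vector subspace of $\prod_{\omega\in\Omega}\mathsf H_\omega$ such that: (a) for every $x\in\mathfrak G$, the function $\omega\mapsto\|x(\omega)\|$ is $\mathcal F$-measurable; (b) every $x\in\prod_{\omega}\mathsf H_\omega$ for which $\omega\mapsto\langle x(\omega),y(\omega)\rangle$ is $\mathcal F$-measurable for all $y\in\mathfrak G$ belongs to $\mathfrak G$; (c) there is a sequence $(e_n)_{n\in\mathbb N}$ in $\mathfrak G$ such that, for every $\omega$, the closed linear span of $\{e_n(\omega)\}_{n\in\mathbb N}$ is $\mathsf H_\omega$. Set $\mathfrak H=\{x\in\mathfrak G : \int_\Omega\|x(\omega)\|^2\,\mu(d\omega)<+\infty\}$. For a set-valued operator $A\colon\mathcal E\to 2^{\mathcal E}$ on a real Hilbert space $\mathcal E$, $A^{-1}$ is the inverse set-valued operator and $J_A=(\mathrm{Id}+A)^{-1}$ is the resolvent; if $A$ is maximally monotone, $J_A$ is single-valued and defined on all of $\mathcal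 E$. For every $\omega\in\Omega$, let $\mathsf A_\omega\colon\mathsf H_\omega\to2^{\mathsf H_\omega}$ be maximally monotone. Suppose that, for every $x\in\mathfrak H$, the mapping $\omega\mapsto J_{\mathsf A_\omega}x(\omega)$ lies in $\mathfrak G$, and that there exist $x,x^*\in\mathfrak H$ such that $x^*(\omega)\in\mathsf A_\omega x(\omega)$ for $\mu$-almost every $\omega$. Let $\mathsf X$ be a separable real Hilbert space and, for every $\omega\in\Omega$, let $\mathsf L_\omega\colon\mathsf X\to\mathsf H_\omega$ be linear and bounded. Suppose that, for every $\mathsf x\in\mathsf X$, the mapping $\omega\mapsto\mathsf L_\omega\mathsf x$ lies in $\mathfrak G$, and that $0<\int_\Omega\|\mathsf L_\omega\|^2\mu(d\omega)\le1$. For a family $(\mathsf B_\omega)_{\omega\in\Omega}$ of maximally monotone operators $\mathsf B_\omega\colon\mathsf H_\omega\to2^{\mathsf H_\omega}$, let $$\mathsf M(\mathsf L_\omega,\mathsf B_\omega)_{\omega\in\Omega}=\Big(\int_\Omega(\mathsf L_\omega^*\circ J_{\mathsf B_\omega}\circ\mathsf L_\omega)\,\mu(d\omega)\Big)^{-1}-\mathrm{Id}_{\mathsf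 X}$$ be the integral resolvent mixture, where $\int_\Omega(\mathsf L_\omega^*\circ J_{\mathsf B_\omega}\circ\mathsf L_\omega)\,\mu(d\omega)$ is the operator $\mathsf x\mapsto\int_\Omega\mathsf L_\omega^*(J_{\mathsf B_\omega}(\mathsf L_\omega\mathsf x))\,\mu(d\omega)$, defined at those $\mathsf x\in\mathsf X$ for which the integrand is integrable, and let $$\mathsf C(\mathsf L_\omega,\mathsf B_\omega)_{\omega\in\Omega}=\big(\mathsf M(\mathsf L_\omega,\mathsf B_\omega^{-1})_{\omega\in\Omega}\big)^{-1}$$ be the integral resolvent comixture. Let $\mathsf V\neq\{0\}$ be a closed vector subspace of $\mathsf X$ with projection operator $\mathrm{proj}_{\mathsf V}$, let $\gamma\in\left]0,+\infty\right[$, set $\mathsf C_\gamma=\mathsf C(\mathsf L_\omega,\gamma\mathsf A_\omega)_{\omega\in\Omega}$, and consider the relaxed problem $$\text{find }\mathsf x\in\mathsf X\text{ such that }\;0\in\Big(\big(\mathrm{proj}_{\mathsf V}^*\circ J_{\mathsf C_\gamma}\circ\mathrm{proj}_{\mathsf V}\big)^{-1}-\mathrm{Id}_{\mathsf X}\Big)\mathsf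 x.\qquad(\mathrm P)$$ **Proposition.** Suppose that (P) has a solution, let $(\lambda_n)_{n\in\mathbb N}$ be a sequence in $\left]0,2\right[$ such that $\sum_{n\in\mathbb N}\lambda_n(2-\lambda_n)=+\infty$, and let $\mathsf x_0\in\mathsf V$. For $n=0,1,\ldots$, iterate: for $\mu$-almost every $\omega\in\Omega$, $y_n(\omega)=\mathsf L_\omega\mathsf x_n$ and $q_n(\omega)=y_n(\omega)-J_{\gamma\mathsf A_\omega}y_n(\omega)$; then $$\mathsf z_n=\int_\Omega\mathsf L_\omega^*(q_n(\omega))\,\mu(d\omega),\qquad \mathsf x_{n+1}=\mathsf x_n-\lambda_n\,\mathrm{proj}_{\mathsf V}\mathsf z_n.$$ Then the integrals defining $(\mathsf z_n)_{n\in\mathbb N}$ exist, that is, for every $n\in\mathbb N$ the mapping $\omega\mapsto\mathsf L_\omega^*(q_n(\omega))$ is $\mu$-integrable, and $(\mathsf x_n)_{n\in\mathbb N}$ converges weakly to a solution of (P). -/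

import Mathlib

open MeasureTheory Filter Topology
open scoped InnerProductSpace

namespace ResolventMixture

/-! ### Set-valued operators on a real Hilbert space -/

section SetValued

variable {E : Type*} [NormedAddCommGroup E] [InnerProductSpace ℝ E]

/-- The inverse `A⁻¹` of a set-valued operator: `x ∈ A⁻¹ u` iff `u ∈ A x`. -/
def inv (A : E → Set E) : E → Set E := fun u => {x | u ∈ A x}

/-- The operator `Id + A`. -/
def idAdd (A : E → Set E) : E → Set E := fun x => {u | ∃ a ∈ A x, u = x + a}

/-- The operator `A - Id`. -/
def subId (A : E → Set E) : E → Set E := fun x => {u | ∃ a ∈ A x, u = a - x}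

/-- The operator `γ A`. -/
def scale (γ : ℝ) (A : E → Set E) : E → Set E := fun x => {u | ∃ a ∈ A x, u = γ • a}

/-- The set of zeros of `A`. -/
def zer (A : E → Set E) : Set E := {x | (0 : E) ∈ A x}

/-- Monotonicity of a set-valued operator. -/
def IsMonotone (A : E → Set E) : Prop :=
  ∀ x y : E, ∀ u ∈ A x, ∀ v ∈ A y, 0 ≤ ⟪x - y, u - v⟫_ℝ

/-- Maximal monotonicity: `A` is monotone and its graph has no proper monotone extension. -/
def IsMaximallyMonotone (A : E → Set E) : Prop :=
  IsMonotone A ∧ ∀ B : E → Set E, IsMonotone B → (∀ x, A x ⊆ B x) → B = A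

/-- The resolvent `J_A = (Id + A)⁻¹`, as a set-valued operator. -/
def setResolvent (A : E → Set E) : E → Set E := inv (idAdd A)

open Classical in
/-- The resolvent of `A` as a map from `E` to `E`. For a maximally monotone operator on a Hilbert
space, `setResolvent A x` is a singleton for every `x`, and `J A x` is its element
(the value `0` is used where `setResolvent A x` is empty). -/
noncomputable def J (A : E → Set E) (x : E) : E :=
  if h : (setResolvent A x).Nonempty then h.some else 0

variable {F : Type*} [NormedAddCommGroup F] [InnerProductSpace ℝ F]
variable [CompleteSpace E] [CompleteSpace F]

/-- The resolvent composition `(L* ∘ J_A ∘ L)⁻¹ - Id` of a set-valued operator `A` with a bounded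
linear operator `L`. -/
def resolventComposition (L : F →L[ℝ] E) (A : E → Set E) : F → Set F :=
  subId (inv fun x => {u | ∃ p ∈ setResolvent A (L x), u = ContinuousLinearMap.adjoint L p})

end SetValued

/-! ### Measurable vector fields, families of operators and their mixtures -/

section Fields

variable {Ω : Type*} [MeasurableSpace Ω] (μ : Measure Ω)
variable {H : Ω → Type*} [∀ ω, NormedAddCommGroup (H ω)] [∀ ω, InnerProductSpace ℝ (H ω)]
variable {X : Type*} [NormedAddCommGroup X] [InnerProductSpace ℝ X]

/-- `((H ω)_ω, G)` is a measurable vector field of real Hilbert spaces. -/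
structure IsMeasurableVectorField (G : Submodule ℝ (∀ ω, H ω)) : Prop where
  measurable_norm : ∀ x ∈ G, Measurable fun ω => ‖x ω‖
  mem_of_measurable_inner : ∀ x : ∀ ω, H ω,
    (∀ y ∈ G, Measurable fun ω => ⟪x ω, y ω⟫_ℝ) → x ∈ G
  exists_fundamental_sequence : ∃ e : ℕ → ∀ ω, H ω, (∀ n, e n ∈ G) ∧
    ∀ ω, (Submodule.span ℝ (Set.range fun n => e n ω)).topologicalClosure = ⊤

/-- The square-integrable elements of `G`; modulo almost everywhere equality, these are the
elements of the Hilbert direct integral of the spaces `H ω` relative to `G`. -/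
def squareIntegrable (G : Submodule ℝ (∀ ω, H ω)) : Set (∀ ω, H ω) :=
  {x | x ∈ G ∧ Integrable (fun ω => ‖x ω‖ ^ 2) μ}

/-- The Hilbert direct integral of the operators `A ω` relative to `G`, in terms of
representatives: its graph consists of the pairs `(x, u)` of square-integrable fields such that
`u ω ∈ A ω (x ω)` almost everywhere, a condition stable under almost everywhere equality. -/
def directIntegral (G : Submodule ℝ (∀ ω, H ω)) (A : ∀ ω, H ω → Set (H ω)) :
    (∀ ω, H ω) → Set (∀ ω, H ω) :=
  fun x => {u | x ∈ squareIntegrable μ G ∧ u ∈ squareIntegrable μ G ∧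
    ∀ᵐ ω ∂μ, u ω ∈ A ω (x ω)}

/-- The standing assumptions on the family of monotone operators. -/
structure IsMonotoneFamily (G : Submodule ℝ (∀ ω, H ω)) (A : ∀ ω, H ω → Set (H ω)) :
    Prop where
  maximallyMonotone : ∀ ω, IsMaximallyMonotone (A ω)
  resolvent_mem : ∀ x ∈ squareIntegrable μ G, (fun ω => J (A ω) (x ω)) ∈ G
  dom_nonempty : ∃ x, (directIntegral μ G A x).Nonempty

/-- The standing assumptions on the family of bounded linear operators. -/
structure IsLinearFamily (G : Submodule ℝ (∀ ω, H ω)) (L : ∀ ω, X →L[ℝ] H ω) : Prop where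
  apply_mem : ∀ x : X, (fun ω => L ω x) ∈ G
  lintegral_pos : 0 < ∫⁻ ω, ‖L ω‖ₑ ^ 2 ∂μ
  lintegral_le_one : ∫⁻ ω, ‖L ω‖ₑ ^ 2 ∂μ ≤ 1

/-- The integral `∫ T ω dμ` of a family of operators from `X` to `X`, as the operator defined at
those `x` for which `ω ↦ T ω x` is integrable. -/
def integralOp (T : Ω → X → X) : X → Set X :=
  fun x => {u | Integrable (fun ω => T ω x) μ ∧ u = ∫ ω, T ω x ∂μ}

variable [∀ ω, CompleteSpace (H ω)] [CompleteSpace X]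

/-- The integral resolvent mixture `(∫ L_ω* ∘ J_{A_ω} ∘ L_ω dμ)⁻¹ - Id`. -/
noncomputable def resolventMixture (L : ∀ ω, X →L[ℝ] H ω) (A : ∀ ω, H ω → Set (H ω)) :
    X → Set X :=
  subId (inv (integralOp μ fun ω x => ContinuousLinearMap.adjoint (L ω) (J (A ω) (L ω x))))

/-- The integral resolvent comixture: the inverse of the integral resolvent mixture of the
inverse operators. -/
noncomputable def resolventComixture (L : ∀ ω, X →L[ℝ] H ω) (A : ∀ ω, H ω → Set (H ω)) :
    X → Set X :=
  inv (resolventMixture μ L fun ω => inv (A ω))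

/-- The solutions of the relaxed problem: the zeros of the resolvent composition with the
projector onto `V` of the integral resolvent comixture of the operators `γ A_ω`. -/
noncomputable def relaxedSolutions (L : ∀ ω, X →L[ℝ] H ω) (A : ∀ ω, H ω → Set (H ω))
    (V : ClosedSubmodule ℝ X) (γ : ℝ) : Set X :=
  zer (resolventComposition V.toSubmodule.starProjection
    (resolventComixture μ L fun ω => scale γ (A ω)))

end Fields

end ResolventMixture

/-!
A solution of the relaxed problem is a point of `V` at which the orthogonal projection of
`T x = ∫ L_ω* (L_ω x - J_{γ A_ω} (L_ω x)) dμ` onto `V` vanishes, because `Id - T` is the resolvent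
of the comixture (`mem_setResolvent_inv_subId_inv`, `mem_zer_resolventComposition_iff`). With `P`
the projector onto `V`, the iteration is `x_{n+1} = x_n - lam_n P T P x_n`. The maps
`Id - J_{γ A_ω}` are firmly nonexpansive, and `∫ ‖L_ω‖ ^ 2 ≤ 1` transfers this property to `T`
(`IsLinearFamily.isFirmlyNonexpansive_integral`), hence to `P T P`. The Krasnosel'skii–Mann theorem
(`IsFirmlyNonexpansive.exists_tendsto_weak`) then gives weak convergence to a zero of `P T P`, which
lies in `V` since `V` is weakly closed.

Two facts are needed for `T` to be defined everywhere. The resolvents are single-valued maps on the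
whole space by Minty's theorem (`IsMaximallyMonotone.setResolvent_nonempty`), proved by maximizing
a concave quadratic function on a simplex for finitely many points of the graph, and by weak
compactness of balls in general. The measurability assumption concerns `J_{A_ω}`, whereas `T`
involves `J_{γ A_ω}`: the latter is a pointwise limit of fields obtained from the former by iterating
a contraction (`IsMonotone.tendsto_scaleStep`, `IsMonotoneFamily.scale_resolvent_mem`), and measurable
fields are stable under pointwise limits. Weak measurability of the integrand is enough because `X`
is separable (`stronglyMeasurable_of_measurable_inner`).
-/

namespace ResolventMixture

section Hilbert

variable {E : Type*} [NormedAddCommGroup E] {A : E → Set E}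

theorem mem_setResolvent {x p : E} : p ∈ setResolvent A x ↔ x - p ∈ A p := by
  constructor
  · rintro ⟨a, ha, rfl⟩
    simpa using ha
  · intro h
    exact ⟨x - p, h, by simp⟩

theorem J_mem {x : E} (h : (setResolvent A x).Nonempty) : J A x ∈ setResolvent A x := by
  rw [J, dif_pos h]
  exact h.some_mem

variable [InnerProductSpace ℝ E]

/-! ### Weak limits of bounded families -/

/-- Weak compactness of balls in a Hilbert space, in terms of ultrafilters. -/
theorem exists_weak_limit [CompleteSpace E] {ι : Type*} (U : Ultrafilter ι) (u : ι → E) {R : ℝ}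
    (hu : ∀ i, ‖u i‖ ≤ R) :
    ∃ p : E, ∀ y : E, Tendsto (fun i => ⟪u i, y⟫_ℝ) U (𝓝 ⟪p, y⟫_ℝ) := by
  let φ : ι → WeakDual ℝ E := fun i =>
    StrongDual.toWeakDual (InnerProductSpace.toDual ℝ E (u i))
  obtain ⟨ψ, -, hψ⟩ := (WeakDual.isCompact_closedBall (0 : StrongDual ℝ E) R).ultrafilter_le_nhds
    (U.map φ) (by
      rw [le_principal_iff]
      refine Ultrafilter.mem_map.2 (Eventually.of_forall fun i => ?_)
      simpa [φ] using hu i)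
  refine ⟨(InnerProductSpace.toDual ℝ E).symm (WeakDual.toStrongDual ψ), fun y => ?_⟩
  rw [InnerProductSpace.toDual_symm_apply]
  exact ((WeakDual.eval_continuous y).tendsto ψ).comp hψ

/-! ### Minty's theorem -/

/-- The finite form of Minty's theorem. With `w i = x - v i`, the `i`-th condition says that `p`
lies in the ball with diameter `[y i, w i]`. The point `p` is the barycentre of the midpoints
`c i` whose weights maximize the concave dual function
`l ↦ ∑ l i * ⟪y i, w i⟫ - ‖∑ l i • c i‖ ^ 2` on the simplex. -/
theorem exists_forall_inner_nonneg {ι : Type*} [Fintype ι] [Nonempty ι] (y v : ι → E)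
    (h : ∀ i j, 0 ≤ ⟪y i - y j, v i - v j⟫_ℝ) (x : E) :
    ∃ p : E, ∀ i, 0 ≤ ⟪p - y i, x - p - v i⟫_ℝ := by
  classical
  set w : ι → E := fun i => x - v i with hw
  set c : ι → E := fun i => (2⁻¹ : ℝ) • (y i + w i) with hc
  set s : ι → ℝ := fun i => ⟪y i, w i⟫_ℝ with hs
  obtain ⟨l, hl, hmax⟩ := (isCompact_stdSimplex ℝ ι).exists_isMaxOn
    ⟨_, single_mem_stdSimplex ℝ (Classical.arbitrary ι)⟩
    (f := fun l : ι → ℝ => ∑ i, l i * s i - ‖∑ i, l i • c i‖ ^ 2)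
    (by fun_prop)
  set p := ∑ i, l i • c i with hp
  set S := ∑ i, l i * s i with hS
  -- The dual function is nonpositive, by monotonicity.
  have hle : S ≤ ‖p‖ ^ 2 := by
    set Y := ∑ i, l i • y i
    set W := ∑ i, l i • w i
    have hpYW : p = (2⁻¹ : ℝ) • (Y + W) := by
      simp only [hp, hc, Y, W, ← Finset.sum_add_distrib, Finset.smul_sum, smul_add]
      refine Finset.sum_congr rfl fun i _ => ?_
      simp only [smul_comm (2⁻¹ : ℝ) (l i)]
    have hYW : ⟪Y, W⟫_ℝ = ∑ i, ∑ j, l i * l j * ⟪y i, w j⟫_ℝ := by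
      simp only [Y, W, sum_inner, inner_sum, real_inner_smul_left, real_inner_smul_right]
      rw [Finset.sum_comm]
      refine Finset.sum_congr rfl fun i _ => Finset.sum_congr rfl fun j _ => by ring
    have hYW' : ⟪Y, W⟫_ℝ = ∑ i, ∑ j, l i * l j * ⟪y j, w i⟫_ℝ := by
      rw [hYW, Finset.sum_comm]
      refine Finset.sum_congr rfl fun i _ => Finset.sum_congr rfl fun j _ => ?_
      rw [mul_comm (l i)]
    have hS1 : S = ∑ i, ∑ j, l i * l j * s i := by
      refine Finset.sum_congr rfl fun i _ => ?_
      rw [← Finset.sum_mul, ← Finset.mul_sum, hl.2, mul_one]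
    have hS2 : S = ∑ i, ∑ j, l i * l j * s j := by
      rw [hS1, Finset.sum_comm]
      refine Finset.sum_congr rfl fun i _ => Finset.sum_congr rfl fun j _ => by ring
    have hdiff : 2 * (⟪Y, W⟫_ℝ - S) =
        ∑ i, ∑ j, l i * l j * ⟪y i - y j, v i - v j⟫_ℝ := by
      have : 2 * (⟪Y, W⟫_ℝ - S) = (∑ i, ∑ j, l i * l j * ⟪y i, w j⟫_ℝ)
          + (∑ i, ∑ j, l i * l j * ⟪y j, w i⟫_ℝ)
          - (∑ i, ∑ j, l i * l j * s i) - ∑ i, ∑ j, l i * l j * s j := by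
        rw [← hYW, ← hYW', ← hS1, ← hS2]; ring
      rw [this]
      simp only [← Finset.sum_add_distrib, ← Finset.sum_sub_distrib]
      refine Finset.sum_congr rfl fun i _ => Finset.sum_congr rfl fun j _ => ?_
      simp only [hs, hw, inner_sub_left, inner_sub_right]
      ring
    have hpos : 0 ≤ 2 * (⟪Y, W⟫_ℝ - S) := by
      rw [hdiff]
      exact Finset.sum_nonneg fun i _ => Finset.sum_nonneg fun j _ =>
        mul_nonneg (mul_nonneg (hl.1 i) (hl.1 j)) (h i j)
    have h4 : ‖p‖ ^ 2 = 4⁻¹ * (‖Y‖ ^ 2 + 2 * ⟪Y, W⟫_ℝ + ‖W‖ ^ 2) := by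
      rw [hpYW, norm_smul, mul_pow, norm_add_sq_real]; norm_num
    nlinarith [norm_sub_sq_real Y W, sq_nonneg ‖Y - W‖]
  refine ⟨p, fun i => ?_⟩
  have hgoal : ⟪p - y i, x - p - v i⟫_ℝ = 2 * ⟪p, c i⟫_ℝ - ‖p‖ ^ 2 - s i := by
    simp only [hc, hs, hw, real_inner_smul_right, inner_sub_left, inner_sub_right, inner_add_right,
      real_inner_self_eq_norm_sq, real_inner_comm p (y i)]
    ring
  rw [hgoal]
  -- Optimality of `l` along the segment towards the `i`-th vertex.
  have hvar : ∀ t : ℝ, 0 ≤ t → t ≤ 1 →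
      t * (s i - S - 2 * ⟪p, c i⟫_ℝ + 2 * ‖p‖ ^ 2) ≤ t ^ 2 * ‖c i - p‖ ^ 2 := by
    intro t ht0 ht1
    have hmem := convex_stdSimplex ℝ ι hl (single_mem_stdSimplex ℝ i) (sub_nonneg.2 ht1) ht0
      (by ring)
    have hopt := hmax hmem
    have h1 : ∑ j, ((1 - t) • l + t • Pi.single i (1 : ℝ) : ι → ℝ) j * s j = (1 - t) * S + t * s i := by
      simp [add_mul, Finset.sum_add_distrib, hS, Finset.mul_sum, mul_assoc, Pi.single_apply]
    have h2 : ∑ j, ((1 - t) • l + t • Pi.single i (1 : ℝ) : ι → ℝ) j • c j = p + t • (c i - p) := by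
      have : ∑ j, ((1 - t) • l + t • Pi.single i (1 : ℝ) : ι → ℝ) j • c j = (1 - t) • p + t • c i := by
        simp [add_smul, Finset.sum_add_distrib, hp, Finset.smul_sum, mul_smul, Pi.single_apply]
      rw [this]; module
    simp only [Set.mem_ofPred_eq, h1, h2] at hopt
    rw [norm_add_sq_real, norm_smul, mul_pow, real_inner_smul_right, inner_sub_right,
      real_inner_self_eq_norm_sq, Real.norm_eq_abs, sq_abs] at hopt
    linarith
  set D := s i - S - 2 * ⟪p, c i⟫_ℝ + 2 * ‖p‖ ^ 2 with hD
  have hD0 : D ≤ 0 := by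
    by_contra! hpos
    have hK : 0 ≤ ‖c i - p‖ ^ 2 := sq_nonneg _
    set K := ‖c i - p‖ ^ 2
    have := hvar (D / (D + K)) (by positivity) ((div_le_one (by positivity)).2 (by linarith))
    rw [sq, mul_assoc, mul_le_mul_iff_right₀ (by positivity), div_mul_eq_mul_div,
      le_div_iff₀ (by positivity)] at this
    nlinarith
  linarith

/-- By maximality, a pair monotonically related to the graph of `A` belongs to it. -/
theorem IsMaximallyMonotone.mem_of_forall (hA : IsMaximallyMonotone A) {p u : E}
    (h : ∀ y, ∀ v ∈ A y, 0 ≤ ⟪p - y, u - v⟫_ℝ) : u ∈ A p := by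
  have hB := hA.2 (fun y => A y ∪ {v | y = p ∧ v = u}) ?_ fun y => Set.subset_union_left
  · rw [← hB]
    exact Or.inr ⟨rfl, rfl⟩
  · rintro y z a (ha | ⟨rfl, rfl⟩) b (hb | ⟨rfl, rfl⟩)
    · exact hA.1 y z a ha b hb
    · rw [← inner_neg_neg, neg_sub, neg_sub]
      exact h y a ha
    · exact h z b hb
    · simp

/-- **Minty's theorem**: the resolvent of a maximally monotone operator is defined everywhere. -/
theorem IsMaximallyMonotone.setResolvent_nonempty [CompleteSpace E] (hA : IsMaximallyMonotone A)
    (x : E) : (setResolvent A x).Nonempty := by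
  classical
  suffices ∃ p, ∀ y, ∀ v ∈ A y, 0 ≤ ⟪p - y, x - p - v⟫_ℝ by
    obtain ⟨p, hp⟩ := this
    exact ⟨p, mem_setResolvent.2 (hA.mem_of_forall hp)⟩
  by_cases hne : ∃ y v, v ∈ A y
  swap
  · push Not at hne
    exact ⟨0, fun y v hv => absurd hv (hne y v)⟩
  obtain ⟨y₀, v₀, h₀⟩ := hne
  have hfin : ∀ S : Finset {g : E × E // g.2 ∈ A g.1}, ∃ p : E,
      ∀ g ∈ insert ⟨(y₀, v₀), h₀⟩ S, 0 ≤ ⟪p - g.1.1, x - p - g.1.2⟫_ℝ := by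
    intro S
    have : Nonempty {g // g ∈ insert ⟨(y₀, v₀), h₀⟩ S} := ⟨⟨_, Finset.mem_insert_self _ _⟩⟩
    obtain ⟨p, hp⟩ := exists_forall_inner_nonneg
      (fun g : {g // g ∈ insert ⟨(y₀, v₀), h₀⟩ S} => g.1.1.1) (fun g => g.1.1.2)
      (fun i j => hA.1 _ _ _ i.1.2 _ j.1.2) x
    exact ⟨p, fun g hg => hp ⟨g, hg⟩⟩
  choose p hp using hfin
  -- The condition at the fixed pair `(y₀, v₀)` keeps the points `p S` in a ball.
  have hbd : ∀ S, ‖p S‖ ≤ ‖y₀‖ + ‖x - v₀ - y₀‖ := by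
    intro S
    have h1 := hp S _ (Finset.mem_insert_self _ _)
    simp only at h1
    have h2 : ⟪p S - y₀, x - p S - v₀⟫_ℝ = ⟪p S - y₀, x - v₀ - y₀⟫_ℝ - ‖p S - y₀‖ ^ 2 := by
      rw [← real_inner_self_eq_norm_sq, ← inner_sub_right]
      congr 1
      abel
    have h3 := real_inner_le_norm (p S - y₀) (x - v₀ - y₀)
    have h4 : ‖p S - y₀‖ ≤ ‖x - v₀ - y₀‖ := by
      by_contra! hlt
      nlinarith [norm_nonneg (x - v₀ - y₀)]
    have h5 := norm_add_le y₀ (p S - y₀)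
    rw [add_sub_cancel] at h5
    linarith
  obtain ⟨q, hq⟩ := exists_weak_limit (Ultrafilter.of atTop) p hbd
  refine ⟨q, fun y v hv => ?_⟩
  have hev : ∀ᶠ S in (Ultrafilter.of atTop : Ultrafilter (Finset {g : E × E // g.2 ∈ A g.1})),
      2 * ⟪p S, q⟫_ℝ - ‖q‖ ^ 2 ≤ ⟪p S, x - v + y⟫_ℝ - ⟪y, x - v⟫_ℝ := by
    refine Ultrafilter.of_le atTop ?_
    filter_upwards [eventually_ge_atTop {⟨(y, v), hv⟩}] with S hS
    have h1 := hp S ⟨(y, v), hv⟩ (Finset.mem_insert_of_mem (hS (Finset.mem_singleton_self _)))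
    simp only [inner_sub_left, inner_sub_right, real_inner_self_eq_norm_sq] at h1
    have h2 := norm_sub_sq_real (p S) q
    simp only [inner_sub_right, inner_add_right, real_inner_comm y (p S)] at h1 ⊢
    nlinarith [sq_nonneg ‖p S - q‖, real_inner_comm y (p S)]
  have hlim := le_of_tendsto_of_tendsto (((hq q).const_mul 2).sub_const (‖q‖ ^ 2))
    ((hq (x - v + y)).sub_const ⟪y, x - v⟫_ℝ) hev
  rw [real_inner_self_eq_norm_sq] at hlim
  simp only [inner_sub_left, inner_sub_right, inner_add_right, real_inner_self_eq_norm_sq]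
    at hlim ⊢
  linarith [real_inner_comm y q]

/-! ### Resolvents of monotone operators -/

theorem IsMonotone.norm_sub_sq_le_inner (hA : IsMonotone A) {x y p q : E}
    (hp : p ∈ setResolvent A x) (hq : q ∈ setResolvent A y) :
    ‖p - q‖ ^ 2 ≤ ⟪p - q, x - y⟫_ℝ := by
  have h := hA p q _ (mem_setResolvent.1 hp) _ (mem_setResolvent.1 hq)
  rw [show x - p - (y - q) = (x - y) - (p - q) by abel, inner_sub_right,
    real_inner_self_eq_norm_sq] at h
  linarith

theorem IsMonotone.J_eq (hA : IsMonotone A) {x p : E} (hp : p ∈ setResolvent A x) :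
    J A x = p := by
  have h := hA.norm_sub_sq_le_inner (J_mem ⟨p, hp⟩) hp
  rw [sub_self, inner_zero_right] at h
  exact sub_eq_zero.1 (norm_eq_zero.1 (pow_eq_zero_iff two_ne_zero |>.1
    (le_antisymm h (sq_nonneg _))))

/-- The map `F` is firmly nonexpansive. -/
def IsFirmlyNonexpansive (F : E → E) : Prop :=
  ∀ x y, ‖F x - F y‖ ^ 2 ≤ ⟪F x - F y, x - y⟫_ℝ

theorem IsFirmlyNonexpansive.norm_map_sub_le {F : E → E} (hF : IsFirmlyNonexpansive F) (x y : E) :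
    ‖F x - F y‖ ≤ ‖x - y‖ := by
  have h := (hF x y).trans (real_inner_le_norm _ _)
  by_contra! hlt
  nlinarith [norm_nonneg (x - y)]

theorem IsFirmlyNonexpansive.continuous {F : E → E} (hF : IsFirmlyNonexpansive F) :
    Continuous F :=
  (LipschitzWith.of_dist_le_mul (K := 1) fun x y => by
    simpa [dist_eq_norm] using hF.norm_map_sub_le x y).continuous

theorem IsFirmlyNonexpansive.id_sub {F : E → E} (hF : IsFirmlyNonexpansive F) :
    IsFirmlyNonexpansive fun x => x - F x := by
  intro x y
  have h := hF x y
  rw [real_inner_comm] at h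
  rw [sub_sub_sub_comm, norm_sub_sq_real, inner_sub_left (x - y), real_inner_self_eq_norm_sq,
    real_inner_comm (x - y)]
  linarith [real_inner_comm (x - y) (F x - F y)]

/-- The reflection `2 F - Id` of a firmly nonexpansive map is nonexpansive. -/
theorem IsFirmlyNonexpansive.norm_reflection_sub_le {F : E → E} (hF : IsFirmlyNonexpansive F)
    (x y : E) : ‖((2 : ℝ) • F x - x) - ((2 : ℝ) • F y - y)‖ ≤ ‖x - y‖ := by
  have h1 : ((2 : ℝ) • F x - x) - ((2 : ℝ) • F y - y) = (2 : ℝ) • (F x - F y) - (x - y) := by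
    module
  have h2 := norm_sub_sq_real ((2 : ℝ) • (F x - F y)) (x - y)
  rw [norm_smul, real_inner_smul_left, Real.norm_two] at h2
  rw [h1]
  have h3 : ‖(2 : ℝ) • (F x - F y) - (x - y)‖ ^ 2 ≤ ‖x - y‖ ^ 2 := by
    nlinarith [hF x y]
  exact (sq_le_sq₀ (norm_nonneg _) (norm_nonneg _)).1 h3

theorem IsMonotone.isFirmlyNonexpansive_J (hA : IsMonotone A)
    (hr : ∀ x, (setResolvent A x).Nonempty) : IsFirmlyNonexpansive (J A) := fun x y =>
  hA.norm_sub_sq_le_inner (J_mem (hr x)) (J_mem (hr y))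

theorem IsMonotone.inv (hA : IsMonotone A) : IsMonotone (inv A) := by
  intro x y u hu v hv
  rw [real_inner_comm]
  exact hA u v x hu y hv

/-- The resolvent of the inverse operator is `Id - J_A`. -/
theorem IsMonotone.J_inv (hA : IsMonotone A) {x : E} (hr : (setResolvent A x).Nonempty) :
    J (ResolventMixture.inv A) x = x - J A x := by
  refine hA.inv.J_eq (mem_setResolvent.2 ?_)
  rw [sub_sub_cancel]
  exact mem_setResolvent.1 (J_mem hr)

theorem IsMonotone.scale (hA : IsMonotone A) {γ : ℝ} (hγ : 0 ≤ γ) : IsMonotone (scale γ A) := by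
  rintro x y _ ⟨a, ha, rfl⟩ _ ⟨b, hb, rfl⟩
  rw [← smul_sub, real_inner_smul_right]
  exact mul_nonneg hγ (hA x y a ha b hb)

/-- A map whose fixed point `w` satisfies `x = J_A w + γ (w - J_A w)`, hence
`J_{γA} x = J_A w`. It is a contraction with constant `|γ - 1| / (1 + γ)`, the reflected resolvent
`2 J_A - Id` being nonexpansive. -/
noncomputable def scaleStep (A : E → Set E) (γ : ℝ) (x w : E) : E :=
  (2 / (1 + γ)) • x + ((γ - 1) / (1 + γ)) • ((2 : ℝ) • J A w - w)

/-- The resolvent of `γ A` as a limit of combinations of resolvents of `A`. -/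
theorem IsMonotone.tendsto_scaleStep [CompleteSpace E] (hA : IsMonotone A)
    (hr : ∀ x, (setResolvent A x).Nonempty) {γ : ℝ} (hγ : 0 < γ) (x : E) :
    (setResolvent (ResolventMixture.scale γ A) x).Nonempty ∧
      Tendsto (fun n => J A ((scaleStep A γ x)^[n] 0)) atTop
        (𝓝 (J (ResolventMixture.scale γ A) x)) := by
  have hJ := hA.isFirmlyNonexpansive_J hr
  have hK : |(γ - 1) / (1 + γ)| < 1 := by
    rw [abs_lt, lt_div_iff₀ (by positivity), div_lt_iff₀ (by positivity)]
    constructor <;> linarith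
  have hc : ContractingWith ⟨|(γ - 1) / (1 + γ)|, abs_nonneg _⟩ (scaleStep A γ x) := by
    refine ⟨hK, LipschitzWith.of_dist_le_mul fun v w => ?_⟩
    rw [dist_eq_norm, dist_eq_norm, scaleStep, scaleStep, add_sub_add_left_eq_sub, ← smul_sub,
      norm_smul]
    exact mul_le_mul_of_nonneg_left (hJ.norm_reflection_sub_le v w) (abs_nonneg _)
  set w := hc.fixedPoint (scaleStep A γ x)
  have hw : scaleStep A γ x w = w := hc.fixedPoint_isFixedPt
  have hmem : J A w ∈ setResolvent (ResolventMixture.scale γ A) x := by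
    refine mem_setResolvent.2 ⟨w - J A w, mem_setResolvent.1 (J_mem (hr w)), ?_⟩
    have h1 : (1 + γ) • scaleStep A γ x w = (2 : ℝ) • x + (γ - 1) • ((2 : ℝ) • J A w - w) := by
      rw [scaleStep, smul_add, smul_smul, smul_smul, mul_div_cancel₀ _ (by positivity),
        mul_div_cancel₀ _ (by positivity)]
    rw [hw] at h1
    have h2 : (2 : ℝ) • (x - J A w) = (2 : ℝ) • γ • (w - J A w) := by
      rw [← sub_eq_zero] at h1 ⊢
      rw [← neg_eq_zero, ← h1]
      module
    exact smul_right_injective E (two_ne_zero (α := ℝ)) h2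
  refine ⟨⟨_, hmem⟩, ?_⟩
  rw [(hA.scale hγ.le).J_eq hmem]
  exact (hJ.continuous.tendsto w).comp (hc.tendsto_iterate_fixedPoint 0)

end Hilbert

/-! ### The Krasnosel'skii–Mann iteration -/

section KrasnoselskiiMann

variable {E : Type*} [NormedAddCommGroup E] [InnerProductSpace ℝ E]

theorem tendsto_toWeakSpace_of_tendsto_inner [CompleteSpace E] {ι : Type*} {l : Filter ι}
    {u : ι → E} {p : E} (h : ∀ y, Tendsto (fun i => ⟪u i, y⟫_ℝ) l (𝓝 ⟪p, y⟫_ℝ)) :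
    Tendsto (fun i => toWeakSpace ℝ E (u i)) l (𝓝 (toWeakSpace ℝ E p)) := by
  have hinj : Function.Injective (topDualPairing ℝ E).flip := by
    intro a b hab
    refine ext_inner_left ℝ fun y => ?_
    exact LinearMap.congr_fun hab (InnerProductSpace.toDual ℝ E y)
  refine (WeakBilin.tendsto_iff_forall_eval_tendsto _ hinj).2 fun f => ?_
  obtain ⟨y, rfl⟩ := (InnerProductSpace.toDual ℝ E).surjective f
  have := h y
  simp only [real_inner_comm y] at this
  exact this

variable {F : E → E} {lam : ℕ → ℝ} {x : ℕ → E}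

/-- Fejér monotonicity of the iteration, with the decrease given by `F (x n)`. -/
theorem IsFirmlyNonexpansive.norm_step_sq_le (hF : IsFirmlyNonexpansive F) {p : E}
    (hp : F p = 0) {t : ℝ} (ht : 0 ≤ t) (a : E) :
    ‖a - t • F a - p‖ ^ 2 ≤ ‖a - p‖ ^ 2 - t * (2 - t) * ‖F a‖ ^ 2 := by
  have h1 := hF a p
  rw [hp, sub_zero] at h1
  rw [sub_right_comm, norm_sub_sq_real, real_inner_smul_right, norm_smul, mul_pow,
    Real.norm_eq_abs, sq_abs, real_inner_comm]
  nlinarith [mul_le_mul_of_nonneg_left h1 ht]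

/-- The residuals decrease along the iteration. -/
theorem IsFirmlyNonexpansive.norm_apply_step_le (hF : IsFirmlyNonexpansive F) {t : ℝ}
    (ht : t ∈ Set.Ioo (0 : ℝ) 2) (a : E) : ‖F (a - t • F a)‖ ≤ ‖F a‖ := by
  set b := F (a - t • F a) with hb
  have h1 := hF a (a - t • F a)
  rw [← hb, sub_sub_cancel, real_inner_smul_right] at h1
  have h2 : 0 ≤ ⟪F a - b, F a⟫_ℝ := by
    by_contra! h
    nlinarith [sq_nonneg ‖F a - b‖, mul_neg_of_pos_of_neg ht.1 h]
  have h3 : ‖b‖ ^ 2 = ‖F a - (F a - b)‖ ^ 2 := by rw [sub_sub_cancel]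
  rw [norm_sub_sq_real, real_inner_comm] at h3
  have h4 : ‖b‖ ^ 2 ≤ ‖F a‖ ^ 2 := by
    nlinarith [mul_nonneg (sub_nonneg.2 ht.2.le) h2]
  exact (sq_le_sq₀ (norm_nonneg _) (norm_nonneg _)).1 h4

/-- The residuals tend to zero: they decrease, and their squares weighted by the divergent series
`∑ lam n * (2 - lam n)` are summable. -/
theorem IsFirmlyNonexpansive.tendsto_apply_zero (hF : IsFirmlyNonexpansive F) {p : E}
    (hp : F p = 0) (hlam : ∀ n, lam n ∈ Set.Ioo (0 : ℝ) 2)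
    (hsum : Tendsto (fun N => ∑ n ∈ Finset.range N, lam n * (2 - lam n)) atTop atTop)
    (hx : ∀ n, x (n + 1) = x n - lam n • F (x n)) :
    Tendsto (fun n => F (x n)) atTop (𝓝 0) := by
  have hanti : Antitone fun n => ‖F (x n)‖ := antitone_nat_of_succ_le fun n => by
    rw [hx]
    exact hF.norm_apply_step_le (hlam n) (x n)
  have hpos : ∀ n, 0 ≤ lam n * (2 - lam n) := fun n =>
    mul_nonneg (hlam n).1.le (sub_nonneg.2 (hlam n).2.le)
  have hbd : ∀ N, ∑ n ∈ Finset.range N, lam n * (2 - lam n) * ‖F (x n)‖ ^ 2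
      ≤ ‖x 0 - p‖ ^ 2 - ‖x N - p‖ ^ 2 := by
    intro N
    induction N with
    | zero => simp
    | succ N ih =>
      have h := hF.norm_step_sq_le hp (hlam N).1.le (x N)
      rw [← hx] at h
      rw [Finset.sum_range_succ]
      linarith
  have hprod : ∀ N, (∑ n ∈ Finset.range N, lam n * (2 - lam n)) * ‖F (x N)‖ ^ 2
      ≤ ‖x 0 - p‖ ^ 2 := by
    intro N
    rw [Finset.sum_mul]
    refine (Finset.sum_le_sum fun n hn => ?_).trans
      ((hbd N).trans (sub_le_self _ (sq_nonneg _)))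
    exact mul_le_mul_of_nonneg_left
      (pow_le_pow_left₀ (norm_nonneg _) (hanti (Finset.mem_range.1 hn).le) 2) (hpos n)
  have hsq : Tendsto (fun n => ‖F (x n)‖ ^ 2) atTop (𝓝 0) := by
    refine squeeze_zero' (Eventually.of_forall fun n => sq_nonneg _) ?_
      (hsum.const_div_atTop (‖x 0 - p‖ ^ 2))
    filter_upwards [hsum.eventually_gt_atTop 0] with N hN
    rw [le_div_iff₀ hN, mul_comm]
    exact hprod N
  rw [tendsto_zero_iff_norm_tendsto_zero]
  simpa using hsq.sqrt

/-- The zeros of a firmly nonexpansive map contain the weak limits of bounded families along which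
the map tends to zero. -/
theorem IsFirmlyNonexpansive.apply_eq_zero_of_weak_limit (hF : IsFirmlyNonexpansive F)
    {ι : Type*} {l : Filter ι} [l.NeBot] {u : ι → E} {q : E} {R : ℝ} (hu : ∀ i, ‖u i‖ ≤ R)
    (hq : ∀ y, Tendsto (fun i => ⟪u i, y⟫_ℝ) l (𝓝 ⟪q, y⟫_ℝ))
    (h0 : Tendsto (fun i => F (u i)) l (𝓝 0)) : F q = 0 := by
  have hle : ∀ i, ‖F (u i) - F q‖ ^ 2 ≤
      ‖F (u i)‖ * (R + ‖q‖) - (⟪u i, F q⟫_ℝ - ⟪q, F q⟫_ℝ) := by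
    intro i
    refine (hF (u i) q).trans ?_
    rw [inner_sub_left, real_inner_comm _ (F q), inner_sub_left (u i)]
    have h1 := real_inner_le_norm (F (u i)) (u i - q)
    have h2 := mul_le_mul_of_nonneg_left ((norm_sub_le (u i) q).trans
      (add_le_add_left (hu i) _)) (norm_nonneg (F (u i)))
    linarith
  have hlim : Tendsto (fun i => ‖F (u i)‖ * (R + ‖q‖) - (⟪u i, F q⟫_ℝ - ⟪q, F q⟫_ℝ)) l
      (𝓝 0) := by
    simpa using (h0.norm.mul_const (R + ‖q‖)).sub ((hq (F q)).sub_const ⟪q, F q⟫_ℝ)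
  have h1 := le_of_tendsto_of_tendsto' ((h0.sub_const (F q)).norm.pow 2) hlim hle
  simpa using le_antisymm h1 (sq_nonneg _)

/-- **Krasnosel'skii–Mann theorem** for firmly nonexpansive maps with relaxation parameters
in `(0, 2)`: the iteration converges weakly to a zero of `F`. -/
theorem IsFirmlyNonexpansive.exists_tendsto_weak [CompleteSpace E] (hF : IsFirmlyNonexpansive F)
    {p : E} (hp : F p = 0) (hlam : ∀ n, lam n ∈ Set.Ioo (0 : ℝ) 2)
    (hsum : Tendsto (fun N => ∑ n ∈ Finset.range N, lam n * (2 - lam n)) atTop atTop)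
    (hx : ∀ n, x (n + 1) = x n - lam n • F (x n)) :
    ∃ q, F q = 0 ∧ ∀ y, Tendsto (fun n => ⟪x n, y⟫_ℝ) atTop (𝓝 ⟪q, y⟫_ℝ) := by
  have hanti : ∀ {r : E}, F r = 0 → Antitone fun n => ‖x n - r‖ ^ 2 := fun {r} hr =>
    antitone_nat_of_succ_le fun n => by
      rw [hx]
      refine (hF.norm_step_sq_le hr (hlam n).1.le (x n)).trans (sub_le_self _ ?_)
      exact mul_nonneg (mul_nonneg (hlam n).1.le (sub_nonneg.2 (hlam n).2.le)) (sq_nonneg _)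
  have hbd : ∀ n, ‖x n‖ ≤ ‖x 0 - p‖ + ‖p‖ := by
    intro n
    have h1 := (sq_le_sq₀ (norm_nonneg _) (norm_nonneg _)).1 (hanti hp (Nat.zero_le n))
    have h2 := norm_add_le (x n - p) p
    rw [sub_add_cancel] at h2
    linarith
  have h0 := hF.tendsto_apply_zero hp hlam hsum hx
  have hcluster : ∀ U : Ultrafilter ℕ, (U : Filter ℕ) ≤ atTop →
      ∃ q, F q = 0 ∧ ∀ y, Tendsto (fun n => ⟪x n, y⟫_ℝ) U (𝓝 ⟪q, y⟫_ℝ) := by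
    intro U hU
    obtain ⟨q, hq⟩ := exists_weak_limit U x hbd
    exact ⟨q, hF.apply_eq_zero_of_weak_limit hbd hq (h0.mono_left hU), hq⟩
  -- For zeros `a` and `b` of `F`, the sequence `⟪x n, a - b⟫` converges (Opial).
  have hinner : ∀ a b, F a = 0 → F b = 0 →
      ∃ c, Tendsto (fun n => ⟪x n, a - b⟫_ℝ) atTop (𝓝 c) := by
    intro a b ha hb
    have hconv : ∀ {r : E}, F r = 0 → ∃ c, Tendsto (fun n => ‖x n - r‖ ^ 2) atTop (𝓝 c) :=
      fun {r} hr => ⟨_, tendsto_atTop_ciInf (hanti hr)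
        ⟨0, by rintro _ ⟨n, rfl⟩; exact sq_nonneg _⟩⟩
    obtain ⟨c, hc⟩ := hconv ha
    obtain ⟨d, hd⟩ := hconv hb
    refine ⟨2⁻¹ * (d - c + (‖a‖ ^ 2 - ‖b‖ ^ 2)), ?_⟩
    refine (((hd.sub hc).add_const (‖a‖ ^ 2 - ‖b‖ ^ 2)).const_mul 2⁻¹).congr fun n => ?_
    rw [norm_sub_sq_real, norm_sub_sq_real, inner_sub_right]
    ring
  obtain ⟨q, hFq, hq⟩ := hcluster (Ultrafilter.of atTop) (Ultrafilter.of_le atTop)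
  refine ⟨q, hFq, fun y => (tendsto_iff_ultrafilter _ _ _).2 fun U hU => ?_⟩
  obtain ⟨r, hFr, hr⟩ := hcluster U hU
  obtain ⟨c, hc⟩ := hinner q r hFq hFr
  have h1 := tendsto_nhds_unique (hc.mono_left (Ultrafilter.of_le atTop)) (hq (q - r))
  have h2 := tendsto_nhds_unique (hc.mono_left hU) (hr (q - r))
  have h3 : ⟪q - r, q - r⟫_ℝ = 0 := by rw [inner_sub_left, ← h1, ← h2, sub_self]
  rw [inner_self_eq_zero, sub_eq_zero] at h3
  rw [h3]
  exact hr y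

end KrasnoselskiiMann

/-! ### Weak measurability in separable Hilbert spaces -/

theorem stronglyMeasurable_of_measurable_inner {Ω X : Type*} [MeasurableSpace Ω]
    [NormedAddCommGroup X] [InnerProductSpace ℝ X] [CompleteSpace X]
    [TopologicalSpace.SeparableSpace X] {f : Ω → X}
    (hf : ∀ y : X, Measurable fun ω => ⟪y, f ω⟫_ℝ) : StronglyMeasurable f := by
  obtain ⟨w, b, hb⟩ := exists_hilbertBasis ℝ X
  -- Distinct vectors of an orthonormal family are at distance at least `1`.
  have hdist : Pairwise fun i j : w => Disjoint (Metric.ball (b i) 2⁻¹) (Metric.ball (b j) 2⁻¹) := by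
    intro i j hij
    refine Metric.ball_disjoint_ball ?_
    have h := norm_sub_sq_real (b i) (b j)
    rw [b.orthonormal.1 i, b.orthonormal.1 j, b.orthonormal.2 hij] at h
    rw [dist_eq_norm]
    nlinarith [norm_nonneg (b i - b j)]
  have hw : Countable w := Pairwise.countable_of_isOpen_disjoint hdist
    (fun i => Metric.isOpen_ball) (fun i => Metric.nonempty_ball.2 (by norm_num))
  refine stronglyMeasurable_of_tendsto (atTop : Filter (Finset w))
    (f := fun s ω => ∑ i ∈ s, ⟪b i, f ω⟫_ℝ • b i) (fun s => ?_) ?_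
  · exact Finset.stronglyMeasurable_fun_sum s fun i _ =>
      (hf (b i)).stronglyMeasurable.smul_const (b i)
  · refine tendsto_pi_nhds.2 fun ω => ?_
    have := b.hasSum_repr (f ω)
    simp only [b.repr_apply_apply] at this
    exact this

/-! ### Square-integrable measurable fields -/

section Fields

variable {Ω : Type*} [MeasurableSpace Ω] {μ : Measure Ω}
variable {H : Ω → Type*} [∀ ω, NormedAddCommGroup (H ω)] [∀ ω, InnerProductSpace ℝ (H ω)]
variable {G : Submodule ℝ (∀ ω, H ω)}

theorem zero_mem_squareIntegrable : (0 : ∀ ω, H ω) ∈ squareIntegrable μ G :=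
  ⟨G.zero_mem, by simp⟩

theorem smul_mem_squareIntegrable (c : ℝ) {x : ∀ ω, H ω} (hx : x ∈ squareIntegrable μ G) :
    c • x ∈ squareIntegrable μ G := by
  refine ⟨G.smul_mem c hx.1, (hx.2.const_mul (‖c‖ ^ 2)).congr (Eventually.of_forall fun ω => ?_)⟩
  simp only [Pi.smul_apply, norm_smul, mul_pow]

namespace IsMeasurableVectorField

theorem measurable_inner (hG : IsMeasurableVectorField G) {x y : ∀ ω, H ω} (hx : x ∈ G)
    (hy : y ∈ G) : Measurable fun ω => ⟪x ω, y ω⟫_ℝ := by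
  simp only [real_inner_eq_norm_mul_self_add_norm_mul_self_sub_norm_sub_mul_self_div_two]
  have h1 := hG.measurable_norm x hx
  have h2 := hG.measurable_norm y hy
  have h3 : Measurable fun ω => ‖x ω - y ω‖ := hG.measurable_norm _ (G.sub_mem hx hy)
  exact (((h1.mul h1).add (h2.mul h2)).sub (h3.mul h3)).div_const 2

theorem mem_of_tendsto (hG : IsMeasurableVectorField G) {u : ℕ → ∀ ω, H ω} {x : ∀ ω, H ω}
    (hu : ∀ n, u n ∈ G) (h : ∀ ω, Tendsto (fun n => u n ω) atTop (𝓝 (x ω))) : x ∈ G :=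
  hG.mem_of_measurable_inner x fun _ hy =>
    measurable_of_tendsto_metrizable (fun n => hG.measurable_inner (hu n) hy)
      (tendsto_pi_nhds.2 fun ω => (h ω).inner tendsto_const_nhds)

theorem mem_squareIntegrable_of_le (hG : IsMeasurableVectorField G) {x y : ∀ ω, H ω}
    (hx : x ∈ G) (hy : y ∈ squareIntegrable μ G) (h : ∀ᵐ ω ∂μ, ‖x ω‖ ≤ ‖y ω‖) :
    x ∈ squareIntegrable μ G := by
  refine ⟨hx, hy.2.mono' ((hG.measurable_norm x hx).pow_const 2).aestronglyMeasurable ?_⟩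
  filter_upwards [h] with ω hω
  rw [Real.norm_eq_abs, abs_of_nonneg (sq_nonneg _)]
  exact pow_le_pow_left₀ (norm_nonneg _) hω 2

theorem add_mem_squareIntegrable (hG : IsMeasurableVectorField G) {x y : ∀ ω, H ω}
    (hx : x ∈ squareIntegrable μ G) (hy : y ∈ squareIntegrable μ G) :
    x + y ∈ squareIntegrable μ G := by
  have hxy := G.add_mem hx.1 hy.1
  refine ⟨hxy, ((hx.2.const_mul 2).add (hy.2.const_mul 2)).mono'
    ((hG.measurable_norm _ hxy).pow_const 2).aestronglyMeasurable
    (Eventually.of_forall fun ω => ?_)⟩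
  rw [Real.norm_eq_abs, abs_of_nonneg (sq_nonneg _)]
  simp only [Pi.add_apply]
  nlinarith [norm_add_le (x ω) (y ω), norm_nonneg (x ω + y ω), sq_nonneg (‖x ω‖ - ‖y ω‖)]

theorem sub_mem_squareIntegrable (hG : IsMeasurableVectorField G) {x y : ∀ ω, H ω}
    (hx : x ∈ squareIntegrable μ G) (hy : y ∈ squareIntegrable μ G) :
    x - y ∈ squareIntegrable μ G := by
  have := hG.add_mem_squareIntegrable hx (smul_mem_squareIntegrable (-1) hy)
  rwa [neg_one_smul, ← sub_eq_add_neg] at this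

theorem integrable_inner (hG : IsMeasurableVectorField G) {x y : ∀ ω, H ω}
    (hx : x ∈ squareIntegrable μ G) (hy : y ∈ squareIntegrable μ G) :
    Integrable (fun ω => ⟪x ω, y ω⟫_ℝ) μ := by
  refine (hx.2.add hy.2).mono' (hG.measurable_inner hx.1 hy.1).aestronglyMeasurable
    (Eventually.of_forall fun ω => ?_)
  have h := norm_inner_le_norm (𝕜 := ℝ) (x ω) (y ω)
  simp only [Pi.add_apply]
  nlinarith [sq_nonneg (‖x ω‖ - ‖y ω‖), sq_nonneg ‖x ω‖, sq_nonneg ‖y ω‖]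

/-- Resolvents preserve square integrability as soon as the family of operators has a
square-integrable point `(a, b)` in its graph, since `a = J (a + b)` almost everywhere. -/
theorem resolvent_mem_squareIntegrable (hG : IsMeasurableVectorField G)
    {B : ∀ ω, H ω → Set (H ω)} (hm : ∀ ω, IsMonotone (B ω))
    (hr : ∀ ω x, (setResolvent (B ω) x).Nonempty) {a b : ∀ ω, H ω}
    (ha : a ∈ squareIntegrable μ G) (hb : b ∈ squareIntegrable μ G)
    (hab : ∀ᵐ ω ∂μ, b ω ∈ B ω (a ω)) {x : ∀ ω, H ω} (hx : x ∈ squareIntegrable μ G)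
    (hJ : (fun ω => J (B ω) (x ω)) ∈ G) : (fun ω => J (B ω) (x ω)) ∈ squareIntegrable μ G := by
  have hd : (fun ω => J (B ω) (x ω)) - a ∈ squareIntegrable μ G := by
    refine hG.mem_squareIntegrable_of_le (G.sub_mem hJ ha.1)
      (hG.sub_mem_squareIntegrable hx (hG.add_mem_squareIntegrable ha hb)) ?_
    filter_upwards [hab] with ω hω
    have h := ((hm ω).isFirmlyNonexpansive_J (hr ω)).norm_map_sub_le (x ω) (a ω + b ω)
    rwa [(hm ω).J_eq (x := a ω + b ω) (p := a ω) (mem_setResolvent.2 (by simpa using hω))] at h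
  simpa using hG.add_mem_squareIntegrable hd ha

end IsMeasurableVectorField

/-- The resolvents of the operators `γ A_ω` send square-integrable fields to square-integrable
fields: they are limits of fields built from the resolvents of the operators `A_ω`. -/
theorem IsMonotoneFamily.scale_resolvent_mem [∀ ω, CompleteSpace (H ω)]
    (hG : IsMeasurableVectorField G) {A : ∀ ω, H ω → Set (H ω)} (hA : IsMonotoneFamily μ G A)
    {γ : ℝ} (hγ : 0 < γ) {x : ∀ ω, H ω} (hx : x ∈ squareIntegrable μ G) :
    (fun ω => J (scale γ (A ω)) (x ω)) ∈ squareIntegrable μ G := by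
  obtain ⟨a, b, ha, hb, hab⟩ := hA.dom_nonempty
  have hm := fun ω => (hA.maximallyMonotone ω).1
  have hr := fun ω => (hA.maximallyMonotone ω).setResolvent_nonempty
  have hJ : ∀ {w : ∀ ω, H ω}, w ∈ squareIntegrable μ G →
      (fun ω => J (A ω) (w ω)) ∈ squareIntegrable μ G := fun {w} hw =>
    hG.resolvent_mem_squareIntegrable hm hr ha hb hab hw (hA.resolvent_mem w hw)
  have hiter : ∀ n : ℕ, (fun ω => (scaleStep (A ω) γ (x ω))^[n] 0) ∈ squareIntegrable μ G := by
    intro n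
    induction n with
    | zero => exact zero_mem_squareIntegrable
    | succ n ih =>
      simp only [Function.iterate_succ_apply']
      exact hG.add_mem_squareIntegrable (smul_mem_squareIntegrable _ hx)
        (smul_mem_squareIntegrable _
          (hG.sub_mem_squareIntegrable (smul_mem_squareIntegrable 2 (hJ ih)) ih))
  have hmem : (fun ω => J (scale γ (A ω)) (x ω)) ∈ G :=
    hG.mem_of_tendsto (fun n => (hJ (hiter n)).1) fun ω =>
      ((hm ω).tendsto_scaleStep (hr ω) hγ (x ω)).2
  refine hG.resolvent_mem_squareIntegrable (fun ω => (hm ω).scale hγ.le)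
    (fun ω y => ((hm ω).tendsto_scaleStep (hr ω) hγ y).1) ha
    (smul_mem_squareIntegrable γ hb) ?_ hx hmem
  filter_upwards [hab] with ω hω
  exact ⟨b ω, hω, rfl⟩

/-! ### Integrals of compositions with a family of bounded linear operators -/

variable {X : Type*} [NormedAddCommGroup X] [InnerProductSpace ℝ X]
variable {L : ∀ ω, X →L[ℝ] H ω}

/-- The bound `‖L_ω x‖ ≤ ‖L_ω‖ ‖x‖`, integrated. -/
theorem IsLinearFamily.lintegral_apply_le (hL : IsLinearFamily μ G L) (x : X) :
    ∫⁻ ω, ‖L ω x‖ₑ ^ 2 ∂μ ≤ ‖x‖ₑ ^ 2 := by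
  calc ∫⁻ ω, ‖L ω x‖ₑ ^ 2 ∂μ ≤ ∫⁻ ω, ‖L ω‖ₑ ^ 2 * ‖x‖ₑ ^ 2 ∂μ := by
        refine lintegral_mono fun ω => ?_
        rw [← mul_pow]
        exact pow_le_pow_left' ((L ω).le_opENorm x) 2
    _ = (∫⁻ ω, ‖L ω‖ₑ ^ 2 ∂μ) * ‖x‖ₑ ^ 2 := lintegral_mul_const' _ _ (by simp)
    _ ≤ 1 * ‖x‖ₑ ^ 2 := by gcongr; exact hL.lintegral_le_one
    _ = ‖x‖ₑ ^ 2 := one_mul _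

theorem IsLinearFamily.apply_mem_squareIntegrable (hG : IsMeasurableVectorField G)
    (hL : IsLinearFamily μ G L) (x : X) : (fun ω => L ω x) ∈ squareIntegrable μ G := by
  refine ⟨hL.apply_mem x,
    ((hG.measurable_norm _ (hL.apply_mem x)).pow_const 2).aestronglyMeasurable, ?_⟩
  refine lt_of_le_of_lt ?_ ((hL.lintegral_apply_le x).trans_lt (by simp))
  simp

theorem IsLinearFamily.integral_apply_le (hG : IsMeasurableVectorField G)
    (hL : IsLinearFamily μ G L) (x : X) : ∫ ω, ‖L ω x‖ ^ 2 ∂μ ≤ ‖x‖ ^ 2 := by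
  rw [integral_eq_lintegral_of_nonneg_ae (Eventually.of_forall fun ω => sq_nonneg _)
    (hL.apply_mem_squareIntegrable hG x).2.1]
  refine ENNReal.toReal_le_of_le_ofReal (sq_nonneg _) ?_
  simpa [ENNReal.ofReal_pow] using hL.lintegral_apply_le x

variable [∀ ω, CompleteSpace (H ω)] [CompleteSpace X] [TopologicalSpace.SeparableSpace X]

theorem IsLinearFamily.integrable_adjoint (hG : IsMeasurableVectorField G)
    (hL : IsLinearFamily μ G L) {r : ∀ ω, H ω} (hr : r ∈ squareIntegrable μ G) :
    Integrable (fun ω => ContinuousLinearMap.adjoint (L ω) (r ω)) μ := by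
  refine ⟨(stronglyMeasurable_of_measurable_inner fun y => ?_).aestronglyMeasurable, ?_⟩
  · simp only [ContinuousLinearMap.adjoint_inner_right]
    exact hG.measurable_inner (hL.apply_mem y) hr.1
  -- The bound `a b ≤ a ^ 2 + b ^ 2` spares the measurability of `‖L_ω‖`: that of `‖r‖` is enough.
  have hmeas : Measurable fun ω => ‖r ω‖ₑ ^ 2 := by
    have := ((hG.measurable_norm r hr.1).ennreal_ofReal).pow_const 2
    simpa using this
  have hfin : ∫⁻ ω, ‖r ω‖ₑ ^ 2 ∂μ < ⊤ := by
    have := hr.2.2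
    simpa [HasFiniteIntegral] using this
  calc ∫⁻ ω, ‖ContinuousLinearMap.adjoint (L ω) (r ω)‖ₑ ∂μ
      ≤ ∫⁻ ω, (‖L ω‖ₑ ^ 2 + ‖r ω‖ₑ ^ 2) ∂μ := by
        refine lintegral_mono fun ω => ?_
        refine ((ContinuousLinearMap.adjoint (L ω)).le_opENorm (r ω)).trans ?_
        rw [LinearIsometryEquiv.enorm_map]
        rcases le_total ‖L ω‖ₑ ‖r ω‖ₑ with h | h
        · refine le_trans ?_ le_add_self
          rw [sq]; gcongr
        · refine le_trans ?_ le_self_add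
          rw [sq]; gcongr
    _ = (∫⁻ ω, ‖L ω‖ₑ ^ 2 ∂μ) + ∫⁻ ω, ‖r ω‖ₑ ^ 2 ∂μ := lintegral_add_right _ hmeas
    _ < ⊤ := ENNReal.add_lt_top.2 ⟨hL.lintegral_le_one.trans_lt ENNReal.one_lt_top, hfin⟩

/-- With `d` the integral, `‖d‖ ^ 2 = ∫ ⟪L_ω d, r ω⟫`, and the contribution `∫ ‖L_ω d‖ ^ 2` of
the first factor is at most `‖d‖ ^ 2`. -/
theorem IsLinearFamily.norm_integral_adjoint_sq_le (hG : IsMeasurableVectorField G)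
    (hL : IsLinearFamily μ G L) {r : ∀ ω, H ω} (hr : r ∈ squareIntegrable μ G) :
    ‖∫ ω, ContinuousLinearMap.adjoint (L ω) (r ω) ∂μ‖ ^ 2 ≤ ∫ ω, ‖r ω‖ ^ 2 ∂μ := by
  set d := ∫ ω, ContinuousLinearMap.adjoint (L ω) (r ω) ∂μ with hd
  have hLd := hL.apply_mem_squareIntegrable hG d
  have h1 : ‖d‖ ^ 2 = ∫ ω, ⟪L ω d, r ω⟫_ℝ ∂μ := by
    rw [← real_inner_self_eq_norm_sq]
    nth_rewrite 2 [hd]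
    rw [← integral_inner (hL.integrable_adjoint hG hr)]
    simp only [ContinuousLinearMap.adjoint_inner_right]
  have h2 : ∫ ω, ⟪L ω d, r ω⟫_ℝ ∂μ ≤ ∫ ω, 2⁻¹ * (‖L ω d‖ ^ 2 + ‖r ω‖ ^ 2) ∂μ := by
    refine integral_mono (hG.integrable_inner hLd hr) ((hLd.2.add hr.2).const_mul _) fun ω => ?_
    have := real_inner_le_norm (L ω d) (r ω)
    simp only
    nlinarith [sq_nonneg (‖L ω d‖ - ‖r ω‖)]
  rw [integral_const_mul, integral_add hLd.2 hr.2] at h2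
  linarith [hL.integral_apply_le hG d]

/-- Since `∫ ‖L_ω‖ ^ 2 ≤ 1`, the map `∫ L_ω* ∘ Q_ω ∘ L_ω` inherits firm nonexpansiveness from the
maps `Q_ω`. -/
theorem IsLinearFamily.isFirmlyNonexpansive_integral (hG : IsMeasurableVectorField G)
    (hL : IsLinearFamily μ G L) {Q : ∀ ω, H ω → H ω} (hQ : ∀ ω, IsFirmlyNonexpansive (Q ω))
    (hmem : ∀ x, (fun ω => Q ω (L ω x)) ∈ squareIntegrable μ G) :
    IsFirmlyNonexpansive fun x => ∫ ω, ContinuousLinearMap.adjoint (L ω) (Q ω (L ω x)) ∂μ := by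
  intro x y
  have hr : (fun ω => Q ω (L ω x) - Q ω (L ω y)) ∈ squareIntegrable μ G :=
    hG.sub_mem_squareIntegrable (hmem x) (hmem y)
  have hLd := hL.apply_mem_squareIntegrable hG (x - y)
  have hdiff : (∫ ω, ContinuousLinearMap.adjoint (L ω) (Q ω (L ω x)) ∂μ)
      - ∫ ω, ContinuousLinearMap.adjoint (L ω) (Q ω (L ω y)) ∂μ
      = ∫ ω, ContinuousLinearMap.adjoint (L ω) (Q ω (L ω x) - Q ω (L ω y)) ∂μ := by
    rw [← integral_sub (hL.integrable_adjoint hG (hmem x)) (hL.integrable_adjoint hG (hmem y))]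
    simp only [map_sub]
  simp only [hdiff]
  refine (hL.norm_integral_adjoint_sq_le hG hr).trans ?_
  rw [real_inner_comm, ← integral_inner (hL.integrable_adjoint hG hr)]
  simp only [ContinuousLinearMap.adjoint_inner_right]
  refine integral_mono hr.2 (hG.integrable_inner hLd hr) fun ω => ?_
  have := hQ ω (L ω x) (L ω y)
  simpa [real_inner_comm, map_sub] using this

end Fields

/-! ### The relaxed problem -/

/-- The resolvent of `(S⁻¹ - Id)⁻¹`, the form of a comixture, is `Id - S`. -/
theorem mem_setResolvent_inv_subId_inv {E : Type*} [NormedAddCommGroup E] {S : E → Set E}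
    {x p : E} : p ∈ setResolvent (inv (subId (inv S))) x ↔ x - p ∈ S x := by
  rw [mem_setResolvent]
  constructor
  · rintro ⟨a, ha, hp⟩
    have : a = x := by rw [eq_sub_iff_add_eq.1 hp |>.symm]; abel
    exact this ▸ ha
  · intro h
    exact ⟨x, h, by abel⟩

/-- The zeros of the resolvent composition with the projector `P` onto `V` of the comixture
associated with an integral operator `T` defined everywhere: `P* (Id - T) P x = x` holds exactly
when `x ∈ V` and `P T x = 0`. -/
theorem mem_zer_resolventComposition_iff {X : Type*} [NormedAddCommGroup X]
    [InnerProductSpace ℝ X] [CompleteSpace X] (V : Submodule ℝ X) [V.HasOrthogonalProjection]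
    {S : X → Set X} {T : X → X} (hS : ∀ x u, u ∈ S x ↔ u = T x) (x : X) :
    x ∈ zer (resolventComposition V.starProjection (inv (subId (inv S)))) ↔
      x ∈ V ∧ V.starProjection (T x) = 0 := by
  have hadj : ContinuousLinearMap.adjoint V.starProjection = V.starProjection :=
    (isSelfAdjoint_starProjection V).adjoint_eq
  have key : x ∈ zer (resolventComposition V.starProjection (inv (subId (inv S)))) ↔
      x = V.starProjection (V.starProjection x - T (V.starProjection x)) := by
    constructor
    · rintro ⟨a, ⟨p, hp, ha⟩, h0⟩
      rw [mem_setResolvent_inv_subId_inv, hS, sub_eq_iff_eq_add, ← sub_eq_iff_eq_add'] at hp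
      rw [hadj, ← hp] at ha
      rwa [sub_eq_zero.1 h0.symm] at ha
    · intro h
      refine ⟨x, ⟨_, mem_setResolvent_inv_subId_inv.2 ((hS _ _).2 (sub_sub_cancel _ _)), ?_⟩,
        (sub_self x).symm⟩
      rwa [hadj]
  rw [key]
  constructor
  · intro h
    have hx : x ∈ V := by
      rw [h]
      exact V.starProjection_apply_mem _
    rw [Submodule.starProjection_eq_self_iff.2 hx, map_sub,
      Submodule.starProjection_eq_self_iff.2 hx] at h
    exact ⟨hx, sub_eq_self.1 h.symm⟩
  · rintro ⟨hx, h⟩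
    rw [Submodule.starProjection_eq_self_iff.2 hx, map_sub,
      Submodule.starProjection_eq_self_iff.2 hx, h, sub_zero]

/-- Compression by an orthogonal projector preserves firm nonexpansiveness. -/
theorem IsFirmlyNonexpansive.starProjection_comp {X : Type*} [NormedAddCommGroup X]
    [InnerProductSpace ℝ X] (V : Submodule ℝ X) [V.HasOrthogonalProjection] {T : X → X}
    (hT : IsFirmlyNonexpansive T) :
    IsFirmlyNonexpansive fun x => V.starProjection (T (V.starProjection x)) := by
  intro x y
  simp only [← map_sub]
  rw [V.inner_starProjection_left_eq_right, map_sub V.starProjection x y]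
  exact (pow_le_pow_left₀ (norm_nonneg _) (V.norm_starProjection_apply_le _) 2).trans (hT _ _)

end ResolventMixture

open ResolventMixture in
theorem propositionp
    {Ω : Type*} [MeasurableSpace Ω] (μ : Measure Ω) [μ.IsComplete] [SigmaFinite μ]
    {H : Ω → Type*} [∀ ω, NormedAddCommGroup (H ω)] [∀ ω, InnerProductSpace ℝ (H ω)]
    [∀ ω, CompleteSpace (H ω)]
    {X : Type*} [NormedAddCommGroup X] [InnerProductSpace ℝ X] [CompleteSpace X]
    [TopologicalSpace.SeparableSpace X]
    (G : Submodule ℝ (∀ ω, H ω)) (hG : ResolventMixture.IsMeasurableVectorField G)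
    (A : ∀ ω, H ω → Set (H ω)) (hA : ResolventMixture.IsMonotoneFamily μ G A)
    (L : ∀ ω, X →L[ℝ] H ω) (hL : ResolventMixture.IsLinearFamily μ G L)
    (V : ClosedSubmodule ℝ X) (hV : V ≠ ⊥) (γ : ℝ) (hγ : 0 < γ)
    (hS : (ResolventMixture.relaxedSolutions μ L A V γ).Nonempty)
    (lam : ℕ → ℝ) (hlam : ∀ n, lam n ∈ Set.Ioo (0 : ℝ) 2)
    (hlam_sum : Tendsto (fun N => ∑ n ∈ Finset.range N, lam n * (2 - lam n)) atTop atTop)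
    (x z : ℕ → X) (y q : ℕ → ∀ ω, H ω)
    (hx0 : x 0 ∈ V)
    (hy : ∀ n, ∀ᵐ ω ∂μ, y n ω = L ω (x n))
    (hq : ∀ n, ∀ᵐ ω ∂μ,
      q n ω = y n ω - ResolventMixture.J (ResolventMixture.scale γ (A ω)) (y n ω))
    (hz : ∀ n, z n = ∫ ω, ContinuousLinearMap.adjoint (L ω) (q n ω) ∂μ)
    (hx : ∀ n, x (n + 1) = x n - lam n • V.toSubmodule.starProjection (z n)) :
    (∀ n, Integrable (fun ω => ContinuousLinearMap.adjoint (L ω) (q n ω)) μ) ∧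
      ∃ xbar ∈ ResolventMixture.relaxedSolutions μ L A V γ,
        Tendsto (fun n => toWeakSpace ℝ X (x n)) atTop (𝓝 (toWeakSpace ℝ X xbar)) := by
  have hm := fun ω => (hA.maximallyMonotone ω).1.scale hγ.le
  have hr := fun ω u => ((hA.maximallyMonotone ω).1.tendsto_scaleStep
    (hA.maximallyMonotone ω).setResolvent_nonempty hγ u).1
  set Q : ∀ ω, H ω → H ω := fun ω u => u - J (scale γ (A ω)) u
  have hQ : ∀ ω, IsFirmlyNonexpansive (Q ω) := fun ω =>
    ((hm ω).isFirmlyNonexpansive_J (hr ω)).id_sub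
  have hmem : ∀ u : X, (fun ω => Q ω (L ω u)) ∈ squareIntegrable μ G := fun u =>
    have hu := hL.apply_mem_squareIntegrable hG u
    hG.sub_mem_squareIntegrable hu (hA.scale_resolvent_mem hG hγ hu)
  set T : X → X := fun u => ∫ ω, ContinuousLinearMap.adjoint (L ω) (Q ω (L ω u)) ∂μ
  have hint : ∀ u : X, Integrable (fun ω => ContinuousLinearMap.adjoint (L ω) (Q ω (L ω u))) μ :=
    fun u => hL.integrable_adjoint hG (hmem u)
  have hsol : ∀ u, u ∈ relaxedSolutions μ L A V γ ↔
      u ∈ V.toSubmodule ∧ V.toSubmodule.starProjection (T u) = 0 := by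
    refine fun u => mem_zer_resolventComposition_iff V.toSubmodule (fun a b => ?_) u
    simp only [(hm _).J_inv (hr _ _)]
    exact ⟨fun h => h.2, fun h => ⟨hint a, h⟩⟩
  have hqQ : ∀ n, (fun ω => ContinuousLinearMap.adjoint (L ω) (q n ω)) =ᵐ[μ]
      fun ω => ContinuousLinearMap.adjoint (L ω) (Q ω (L ω (x n))) := fun n => by
    filter_upwards [hy n, hq n] with ω h1 h2
    rw [h2, h1]
  refine ⟨fun n => (hint (x n)).congr (hqQ n).symm, ?_⟩
  have hzT : ∀ n, z n = T (x n) := fun n => (hz n).trans (integral_congr_ae (hqQ n))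
  have hxV : ∀ n, x n ∈ V.toSubmodule := fun n => by
    induction n with
    | zero => exact hx0
    | succ n ih =>
      rw [hx]
      exact V.toSubmodule.sub_mem ih
        (V.toSubmodule.smul_mem _ (V.toSubmodule.starProjection_apply_mem _))
  have hP : ∀ {u}, u ∈ V.toSubmodule → V.toSubmodule.starProjection u = u := fun hu =>
    Submodule.starProjection_eq_self_iff.2 hu
  have hF := (hL.isFirmlyNonexpansive_integral hG hQ hmem).starProjection_comp V.toSubmodule
  obtain ⟨p, hp⟩ := hS
  obtain ⟨hpV, hTp⟩ := (hsol p).1 hp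
  obtain ⟨u, hu, hlim⟩ := hF.exists_tendsto_weak (p := p) (by rw [hP hpV]; exact hTp) hlam hlam_sum
    (x := x) (fun n => by rw [hx, hzT, hP (hxV n)])
  have huV : u ∈ V.toSubmodule := by
    -- `V` is weakly closed, being the orthogonal complement of `Vᗮ`.
    rw [← V.toSubmodule.orthogonal_orthogonal]
    refine (Submodule.mem_orthogonal' _ _).2 fun w hw => ?_
    refine tendsto_nhds_unique (hlim w) (tendsto_const_nhds.congr fun n => ?_)
    exact ((Submodule.mem_orthogonal _ _).1 hw _ (hxV n)).symm
  rw [hP huV] at hu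
  exact ⟨u, (hsol u).2 ⟨huV, hu⟩, tendsto_toWeakSpace_of_tendsto_inner hlim⟩
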